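/- Let $G=(V,E)$ be a finite directed multigraph (loops and parallel edges allowed). For a non-empty directed cycle $\mathcal C$ of $G$ (a closed directed walk), let $\vec e_{\mathcal C}\in\mathbb R^{E}$ be the vector whose $e$-th coordinate is the number of occurrences of $e$ in $\mathcal C$ divided by the length of $\mathcal C$. The cycle polytope $P(G)$ is the convex hull of the vectors $\vec e_{\mathcal C}$ over all simple cycles $\mathcal C$ of $G$, that is, non-empty cycles that do not repeat vertices. A directed multigraph is called full if each of its edges is contained in a directed cycle. The full subgraphs $H$ of $G$ are ordered by inclusion of their edge sets $E(H)$, and full subgraphs with the same edge set (which differ only in isolated vertices) are identified in the resulting poset. The faces of $P(G)$ are the empty set and the sets of maximizers over $P(G)$ of linear functionals (so $P(G)$ itself is a face), ordered by inclusion, and $\dim\emptyset=-1$. Then the map $$H\mapsto P(G)_H:=\{\vec x\in P(G)\mid x_e=0\text{ for all }e\in E\setminus E(H)\}$$ is a well-defined isomorphism from the poset of full subgraphs of $G$ to the poset of faces of $P(G)$. Moreover, for every full subgraph $H$ of $G$, the image of $P(H)$ under the canonical injection $\mathbb R^{E(H)}\hookrightarrow\mathbb R^{E}$ (extension by zero)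 is $P(G)_H$, and $$\dim P(G)_H=|E(H)|-|V(H)|+|\{\text{connected components of }H\}|-1 ,$$ where connectedness ignores the directions of the edges. -/

import Mathlib

/-- A directed multigraph with vertex set `V` and edge set `E`: every edge has a source and a
target. Loops and parallel edges are allowed. -/
structure DirectedMultigraph (V E : Type*) where
  /-- the vertex at which an edge starts -/
  src : E → V
  /-- the vertex at which an edge ends -/
  tgt : E → V

namespace DirectedMultigraph

variable {V E : Type*}

/-- `G.IsWalk u c v`: the list of edges `c` is a directed walk in `G` from `u` to `v`. -/
def IsWalk (G : DirectedMultigraph V E) : V → List E → V → Prop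
  | u, [], v => u = v
  | u, e :: c, v => G.src e = u ∧ G.IsWalk (G.tgt e) c v

/-- A non-empty (directed) cycle of `G`: a non-empty closed directed walk, given by the list of its
edges. -/
def IsCycle (G : DirectedMultigraph V E) (c : List E) : Prop :=
  c ≠ [] ∧ ∃ v, G.IsWalk v c v

/-- A simple cycle: a non-empty cycle that does not repeat vertices. (The vertices of a cycle are
the sources of its successive edges.) -/
def IsSimpleCycle (G : DirectedMultigraph V E) (c : List E) : Prop :=
  G.IsCycle c ∧ (c.map G.src).Nodup

open Classical in
/-- The vector in `ℝ^E` of a cycle `c`: its `e`-th coordinate is the number of occurrences of `e`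
in `c`, divided by the length of `c`. -/
noncomputable def cycleVector (c : List E) : E → ℝ :=
  fun e => (c.count e : ℝ) / (c.length : ℝ)

/-- The cycle polytope `P(G)`: the convex hull of the vectors of the simple cycles of `G`. -/
def cyclePolytope (G : DirectedMultigraph V E) : Set (E → ℝ) :=
  convexHull ℝ {x | ∃ c : List E, G.IsSimpleCycle c ∧ x = cycleVector c}

/-- A directed multigraph is full if every edge is contained in a cycle. -/
def IsFull (G : DirectedMultigraph V E) : Prop :=
  ∀ e : E, ∃ c : List E, G.IsCycle c ∧ e ∈ c

/-- The connected components of `G`: the classes of the equivalence relation on the vertices that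
is generated by "`u` and `v` are joined by an edge" (directions are ignored). -/
def Components (G : DirectedMultigraph V E) : Type _ :=
  Quot fun u v : V => ∃ e : E, G.src e = u ∧ G.tgt e = v

/-- A subgraph of `G`: a set of vertices and a set of edges of `G`, such that the end points of the
chosen edges are among the chosen vertices. -/
structure Subgraph (G : DirectedMultigraph V E) where
  /-- the vertices of the subgraph -/
  verts : Set V
  /-- the edges of the subgraph -/
  edges : Set E
  src_mem : ∀ e ∈ edges, G.src e ∈ verts
  tgt_mem : ∀ e ∈ edges, G.tgt e ∈ verts

/-- A subgraph, as a directed multigraph of its own. -/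
def Subgraph.coe {G : DirectedMultigraph V E} (H : G.Subgraph) :
    DirectedMultigraph H.verts H.edges where
  src e := ⟨G.src e, H.src_mem e e.2⟩
  tgt e := ⟨G.tgt e, H.tgt_mem e e.2⟩

/-- The full subgraphs of `G`. -/
structure FullSubgraph (G : DirectedMultigraph V E) extends G.Subgraph where
  full : toSubgraph.coe.IsFull

/-- Full subgraphs are ordered by inclusion of their edge sets. Since subgraphs may contain isolated
vertices this is only a preorder; the poset of full subgraphs is the associated partial order, in
which full subgraphs with the same edges are identified. -/
instance (G : DirectedMultigraph V E) : Preorder G.FullSubgraph :=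
  Preorder.lift fun H => H.edges

/-- The poset of full subgraphs of `G`, ordered by inclusion of edge sets. -/
abbrev FullSubgraphPoset (G : DirectedMultigraph V E) : Type _ :=
  Antisymmetrization G.FullSubgraph (· ≤ ·)

/-- The set `P(G)_H` of the points `x` of `P(G)` with `x_e = 0` for all edges `e` outside `H`. -/
def restrictedPolytope (G : DirectedMultigraph V E) (H : G.Subgraph) : Set (E → ℝ) :=
  {x ∈ G.cyclePolytope | ∀ e ∉ H.edges, x e = 0}

end DirectedMultigraph

/-- The face poset of a polytope `P`, ordered by inclusion. The faces of `P` are the empty set and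
the sets of maximizers over `P` of linear functionals (so `P` itself is a face). -/
abbrev FacePoset {ι : Type*} (P : Set (ι → ℝ)) : Type _ :=
  {F : Set (ι → ℝ) // IsExposed ℝ P F}

open Classical in
/-- The dimension of a polytope: the dimension of its affine span, and `-1` for the empty
polytope. -/
noncomputable def polytopeDim {ι : Type*} (P : Set (ι → ℝ)) : ℤ :=
  if P = ∅ then -1 else (Module.finrank ℝ (affineSpan ℝ P).direction : ℤ)

namespace DirectedMultigraph

variable {V E : Type*}

/-! Everything follows from a description of `P(G)` by equations and inequalities
(`mem_cyclePolytope_iff`): its points are the nonnegative circulations with coordinate sum 1.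
Indeed, the support of a nonzero nonnegative circulation contains a simple cycle, and subtracting
the largest possible multiple of it shrinks the support.

Faces: setting coordinates to zero exposes a face, since coordinates are nonnegative. Conversely, a
face `F` contains a point `y` positive on every edge that `F` uses. If `z` in `P(G)` lives on these
edges, `y` can be moved slightly away from `z` within `P(G)`, so `z` also maximizes the functional.
Hence `F` is determined by its support, which is full because points of `P(G)` are mixtures of
cycles.

Dimension: if `G` is full, some point is positive everywhere, so the affine span is the whole
hyperplane of sum 1 in the circulation space, whose dimension rank-nullity computes. Extension by
zero transfers this to subgraphs. -/

/-- The circulations of `G`: the vectors that are orthogonal to all coboundaries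
`e ↦ f (tgt e) - f (src e)`. -/
def circulations [Fintype E] (G : DirectedMultigraph V E) : Submodule ℝ (E → ℝ) where
  carrier := {x | ∀ f : V → ℝ, ∑ e, x e * (f (G.tgt e) - f (G.src e)) = 0}
  add_mem' {x y} hx hy f := by
    simp only [Pi.add_apply, add_mul, Finset.sum_add_distrib, hx f, hy f, add_zero]
  zero_mem' f := by simp
  smul_mem' a x hx f := by
    simp only [Pi.smul_apply, smul_eq_mul, mul_assoc, ← Finset.mul_sum, hx f, mul_zero]

theorem mem_circulations [Fintype E] {G : DirectedMultigraph V E} {x : E → ℝ} :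
    x ∈ G.circulations ↔ ∀ f : V → ℝ, ∑ e, x e * (f (G.tgt e) - f (G.src e)) = 0 :=
  Iff.rfl

/-! ### Cycle vectors as circulations -/

theorem IsWalk.sum_map_sub {G : DirectedMultigraph V E} (f : V → ℝ) {c : List E} {u v : V}
    (h : G.IsWalk u c v) : (c.map fun e => f (G.tgt e) - f (G.src e)).sum = f v - f u := by
  induction c generalizing u with
  | nil => simp [show u = v from h]
  | cons e c ih =>
    obtain ⟨rfl, h⟩ := h
    simp [ih h]

theorem sum_cycleVector_mul [Fintype E] (c : List E) (g : E → ℝ) :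
    ∑ e, cycleVector c e * g e = (c.map g).sum / c.length := by
  classical
  simp only [cycleVector, div_mul_eq_mul_div, ← Finset.sum_div]
  congr 1
  induction c with
  | nil => simp
  | cons a c ih =>
    simp only [List.count_cons, Nat.cast_add, add_mul, Finset.sum_add_distrib, List.map_cons,
      List.sum_cons]
    rw [ih, add_comm]
    simp

theorem cycleVector_nonneg (c : List E) (e : E) : 0 ≤ cycleVector c e := by
  unfold cycleVector; positivity

theorem cycleVector_pos {c : List E} {e : E} (h : e ∈ c) : 0 < cycleVector c e := by
  classical
  have h1 : 0 < c.count e := List.count_pos_iff.2 h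
  have h2 : 0 < c.length := List.length_pos_of_mem h
  unfold cycleVector
  convert div_pos (Nat.cast_pos (α := ℝ).2 h1) (Nat.cast_pos.2 h2)

theorem mem_of_cycleVector_pos {c : List E} {e : E} (h : 0 < cycleVector c e) : e ∈ c := by
  classical
  by_contra he
  simp [cycleVector, List.count_eq_zero.2 he] at h

theorem IsCycle.sum_cycleVector [Fintype E] {G : DirectedMultigraph V E} {c : List E}
    (hc : G.IsCycle c) : ∑ e, cycleVector c e = 1 := by
  have h := sum_cycleVector_mul c fun _ => 1
  have : (c.length : ℝ) ≠ 0 := by simpa using hc.1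
  simpa [this] using h

theorem IsCycle.cycleVector_mem_circulations [Fintype E] {G : DirectedMultigraph V E} {c : List E}
    (hc : G.IsCycle c) : cycleVector c ∈ G.circulations := fun f => by
  obtain ⟨-, v, hv⟩ := hc
  rw [sum_cycleVector_mul c fun e => f (G.tgt e) - f (G.src e), hv.sum_map_sub, sub_self, zero_div]

/-! ### Decomposition of nonnegative circulations into simple cycles -/

/-- A non-empty set of edges in which every edge can be continued contains a simple cycle. -/
theorem exists_isSimpleCycle_of_forall_exists [Finite V] (G : DirectedMultigraph V E) {S : Set E}
    (hS : S.Nonempty) (hnext : ∀ e ∈ S, ∃ e' ∈ S, G.src e' = G.tgt e) :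
    ∃ c, G.IsSimpleCycle c ∧ ∀ e ∈ c, e ∈ S := by
  obtain ⟨e₀, he₀⟩ := hS
  have : Nonempty E := ⟨e₀⟩
  have hout : ∀ v, v ∈ G.src '' S → ∃ e, e ∈ S ∧ G.src e = v := fun v hv => hv
  choose! out hout hsrc using hout
  set f : V → V := fun v => G.tgt (out v) with hf
  have hmaps : Set.MapsTo f (G.src '' S) (G.src '' S) := fun v hv => hnext _ (hout v hv)
  have hiter : ∀ k v, v ∈ G.src '' S → f^[k] v ∈ G.src '' S := fun k => hmaps.iterate k
  have hwalk : ∀ n v, v ∈ G.src '' S →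
      G.IsWalk v ((List.range n).map fun k => out (f^[k] v)) (f^[n] v) := by
    intro n
    induction n with
    | zero => intro v _; rfl
    | succ n ih =>
      intro v hv
      rw [List.range_succ_eq_map, List.map_cons, List.map_map]
      exact ⟨hsrc v hv, ih _ (hmaps hv)⟩
  -- By pigeonhole an orbit of `f` becomes periodic; one minimal period visits distinct vertices,
  -- hence gives a simple cycle.
  obtain ⟨v, hv, hper⟩ : ∃ v ∈ G.src '' S, v ∈ Function.periodicPts f := by
    obtain ⟨m, n, hmn, h⟩ := Finite.exists_ne_map_eq_of_infinite fun k => f^[k] (G.src e₀)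
    wlog hlt : m < n generalizing m n
    · exact this n m hmn.symm h.symm (by omega)
    refine ⟨f^[m] (G.src e₀), hiter _ _ ⟨e₀, he₀, rfl⟩,
      Function.mk_mem_periodicPts (n := n - m) (by omega) ?_⟩
    rw [Function.IsPeriodicPt, Function.IsFixedPt, ← Function.iterate_add_apply,
      Nat.sub_add_cancel hlt.le]
    exact h.symm
  have hpos := Function.minimalPeriod_pos_of_mem_periodicPts hper
  refine ⟨(List.range (Function.minimalPeriod f v)).map fun k => out (f^[k] v),
    ⟨⟨by simpa using hpos.ne', v, ?_⟩, ?_⟩, ?_⟩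
  · simpa only [Function.iterate_minimalPeriod] using hwalk (Function.minimalPeriod f v) v hv
  · rw [List.map_map]
    refine List.Nodup.map_on ?_ List.nodup_range
    intro i hi j hj hij
    simp only [Function.comp_apply, hsrc _ (hiter _ _ hv)] at hij
    exact Function.iterate_injOn_Iio_minimalPeriod (by simpa using hi) (by simpa using hj) hij
  · intro e he
    obtain ⟨k, -, rfl⟩ := List.mem_map.1 he
    exact hout _ (hiter _ _ hv)

theorem exists_isSimpleCycle_of_mem_circulations [Finite V] [Fintype E]
    (G : DirectedMultigraph V E) {x : E → ℝ} (hx : x ∈ G.circulations) (hx0 : ∀ e, 0 ≤ x e)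
    (hne : ∃ e, 0 < x e) : ∃ c, G.IsSimpleCycle c ∧ ∀ e ∈ c, 0 < x e := by
  classical
  refine G.exists_isSimpleCycle_of_forall_exists (S := {e | 0 < x e}) hne fun e he => ?_
  by_contra! hno
  -- Conservation at the head of `e`: inflow without outflow would give a positive sum. `hno` also
  -- rules out that `e` is a loop.
  have hsum := hx (Pi.single (G.tgt e) 1)
  have hterm : ∀ e', 0 ≤ x e' * ((Pi.single (G.tgt e) 1 : V → ℝ) (G.tgt e') -
      (Pi.single (G.tgt e) 1 : V → ℝ) (G.src e')) := by
    intro e'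
    rcases (hx0 e').eq_or_lt with h | h
    · simp [← h]
    · rw [Pi.single_eq_of_ne (hno e' h), sub_zero]
      refine mul_nonneg h.le ?_
      rw [Pi.single_apply]; split_ifs <;> simp
  have := (Finset.sum_eq_zero_iff_of_nonneg fun e' _ => hterm e').1 hsum e (Finset.mem_univ e)
  rw [Pi.single_eq_same, Pi.single_eq_of_ne (hno e he), sub_zero, mul_one] at this
  exact (show 0 < x e from he).ne' this

/-- Every nonnegative circulation with positive sum is a positive multiple of a point of the cycle
polytope. -/
theorem inv_sum_smul_mem_cyclePolytope [Finite V] [Fintype E] (G : DirectedMultigraph V E)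
    {x : E → ℝ} (hx : x ∈ G.circulations) (hx0 : ∀ e, 0 ≤ x e) (hpos : 0 < ∑ e, x e) :
    (∑ e, x e)⁻¹ • x ∈ G.cyclePolytope := by
  classical
  induction hn : (Finset.univ.filter fun e => 0 < x e).card using Nat.strong_induction_on
    generalizing x with
  | _ n ih =>
  obtain ⟨c, hc, hcx⟩ := G.exists_isSimpleCycle_of_mem_circulations hx hx0 (by
    by_contra! h
    exact absurd hpos (not_lt.2 (Finset.sum_nonpos fun e _ => h e)))
  have hne : c.toFinset.Nonempty := by
    simpa [Finset.nonempty_iff_ne_empty, List.toFinset_eq_empty_iff] using hc.1.1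
  obtain ⟨e₀, he₀, hmin⟩ := c.toFinset.exists_min_image x hne
  rw [List.mem_toFinset] at he₀
  have hlen : 0 < (c.length : ℝ) := by exact_mod_cast List.length_pos_of_mem he₀
  have ht : 0 < x e₀ := hcx _ he₀
  -- A simple cycle repeats no edge, so this multiple of its vector is `x e₀` on `c` and 0
  -- elsewhere; subtracting it kills `e₀` and, by minimality, keeps `x` nonnegative.
  have hmul : ∀ e, (x e₀ * c.length) * cycleVector c e = if e ∈ c then x e₀ else 0 := by
    intro e
    have hcount : (c.count e : ℝ) = if e ∈ c then 1 else 0 := by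
      rw [(List.Nodup.of_map _ hc.2).count]; push_cast; rfl
    have : cycleVector c e = (if e ∈ c then 1 else 0) / (c.length : ℝ) := by
      rw [← hcount, cycleVector]
    rw [this]
    split_ifs
    · field_simp
    · simp
  set s : ℝ := x e₀ * c.length with hs
  have hspos : 0 < s := mul_pos ht hlen
  set y : E → ℝ := x - s • cycleVector c with hy
  have hye : ∀ e, y e = x e - if e ∈ c then x e₀ else 0 := fun e => by
    simp [hy, hmul]
  have hy0 : ∀ e, 0 ≤ y e := fun e => by
    rw [hye]
    split_ifs with h
    · exact sub_nonneg.2 (hmin e (List.mem_toFinset.2 h))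
    · simpa using hx0 e
  have hyc : y ∈ G.circulations :=
    sub_mem hx (Submodule.smul_mem _ _ hc.1.cycleVector_mem_circulations)
  have hysum : ∑ e, y e = ∑ e, x e - s := by
    simp [hy, ← Finset.mul_sum, hc.1.sum_cycleVector]
  have hcP : cycleVector c ∈ G.cyclePolytope := subset_convexHull _ _ ⟨c, hc, rfl⟩
  have hxy : x = y + s • cycleVector c := by simp [hy]
  rcases (Finset.sum_nonneg fun e (_ : e ∈ Finset.univ) => hy0 e).eq_or_lt with h | h
  · have : y = 0 := by
      ext e
      exact (Finset.sum_eq_zero_iff_of_nonneg fun e _ => hy0 e).1 h.symm e (Finset.mem_univ e)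
    have hxs : ∑ e, x e = s := by linarith
    rw [hxs, hxy, this, zero_add, smul_smul, inv_mul_cancel₀ hspos.ne', one_smul]
    exact hcP
  · have hlt : (Finset.univ.filter fun e => 0 < y e).card < n := by
      rw [← hn]
      refine Finset.card_lt_card (Finset.ssubset_iff_of_subset ?_ |>.2 ⟨e₀, ?_, ?_⟩)
      · intro e he
        simp only [Finset.mem_filter, Finset.mem_univ, true_and, hye] at he ⊢
        split_ifs at he <;> linarith
      · simpa using ht
      · simp [hye, he₀]
    have hyP := ih _ hlt hyc hy0 h rfl
    have hconv := (convex_convexHull ℝ _ : Convex ℝ G.cyclePolytope) hyP hcP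
      (a := (∑ e, y e) / ∑ e, x e) (b := s / ∑ e, x e) (by positivity) (by positivity)
      (by rw [← add_div, hysum, sub_add_cancel, div_self hpos.ne'])
    have hcomb : (∑ e, x e)⁻¹ • x = ((∑ e, y e) / ∑ e, x e) • (∑ e, y e)⁻¹ • y +
        (s / ∑ e, x e) • cycleVector c := by
      have hy' : (∑ e, y e) / (∑ e, x e) * (∑ e, y e)⁻¹ = (∑ e, x e)⁻¹ := by field_simp
      rw [smul_smul, hy', hy, smul_sub, smul_smul, div_eq_inv_mul, sub_add_cancel]
    rw [hcomb]
    exact hconv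

theorem mem_cyclePolytope_iff [Finite V] [Fintype E] {G : DirectedMultigraph V E} {x : E → ℝ} :
    x ∈ G.cyclePolytope ↔ x ∈ G.circulations ∧ (∀ e, 0 ≤ x e) ∧ ∑ e, x e = 1 := by
  refine ⟨fun hx => ?_, fun ⟨hc, h0, h1⟩ => ?_⟩
  · have hconv : Convex ℝ {x : E → ℝ | x ∈ G.circulations ∧ (∀ e, 0 ≤ x e) ∧ ∑ e, x e = 1} := by
      rintro x ⟨hxc, hx0, hx1⟩ y ⟨hyc, hy0, hy1⟩ a b ha hb hab
      refine ⟨add_mem (Submodule.smul_mem _ _ hxc) (Submodule.smul_mem _ _ hyc), fun e => ?_, ?_⟩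
      · exact add_nonneg (mul_nonneg ha (hx0 e)) (mul_nonneg hb (hy0 e))
      · simp [Finset.sum_add_distrib, ← Finset.mul_sum, hx1, hy1, hab]
    refine convexHull_min ?_ hconv hx
    rintro _ ⟨c, hc, rfl⟩
    exact ⟨hc.1.cycleVector_mem_circulations, cycleVector_nonneg c, hc.1.sum_cycleVector⟩
  · simpa [h1] using G.inv_sum_smul_mem_cyclePolytope hc h0 (by simp [h1])

theorem IsCycle.cycleVector_mem_cyclePolytope [Finite V] [Fintype E] {G : DirectedMultigraph V E}
    {c : List E} (hc : G.IsCycle c) : cycleVector c ∈ G.cyclePolytope :=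
  mem_cyclePolytope_iff.2
    ⟨hc.cycleVector_mem_circulations, cycleVector_nonneg c, hc.sum_cycleVector⟩

/-! ### Dimension of the circulation space -/

/-- The coboundary matrix of `G`: it maps `f` to `e ↦ f (tgt e) - f (src e)`. -/
noncomputable def coboundaryMatrix [DecidableEq V] (G : DirectedMultigraph V E) : Matrix E V ℝ :=
  Matrix.of fun e v => (if G.tgt e = v then 1 else 0) - if G.src e = v then 1 else 0

theorem coboundaryMatrix_mulVec [DecidableEq V] [Fintype V] (G : DirectedMultigraph V E)
    (f : V → ℝ) (e : E) :
    (G.coboundaryMatrix.mulVec f) e = f (G.tgt e) - f (G.src e) := by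
  simp [coboundaryMatrix, Matrix.mulVec, dotProduct, sub_mul, Finset.sum_sub_distrib]

theorem circulations_eq_ker [DecidableEq V] [Fintype V] [Fintype E] (G : DirectedMultigraph V E) :
    G.circulations = LinearMap.ker G.coboundaryMatrix.transpose.mulVecLin := by
  ext x
  rw [LinearMap.mem_ker, Matrix.mulVecLin_apply, Matrix.mulVec_transpose, mem_circulations]
  have h : ∀ f : V → ℝ, ∑ e, x e * (f (G.tgt e) - f (G.src e)) =
      Matrix.vecMul x G.coboundaryMatrix ⬝ᵥ f := fun f => by
    rw [← Matrix.dotProduct_mulVec]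
    simp [dotProduct, coboundaryMatrix_mulVec]
  simp only [h]
  exact ⟨fun H => dotProduct_eq_zero _ H, fun H f => by rw [H, zero_dotProduct]⟩

/-- The functions with trivial coboundary are those that are constant on the components. -/
theorem finrank_ker_coboundaryMatrix [DecidableEq V] [Fintype V] (G : DirectedMultigraph V E) :
    Module.finrank ℝ (LinearMap.ker G.coboundaryMatrix.mulVecLin) = Nat.card G.Components := by
  have : Finite G.Components := inferInstanceAs (Finite (Quot _))
  have := Fintype.ofFinite G.Components
  let p : V → G.Components := Quot.mk _
  have hp : Function.Surjective p := Quot.mk_surjective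
  have hrange : LinearMap.range (LinearMap.funLeft ℝ ℝ p) =
      LinearMap.ker G.coboundaryMatrix.mulVecLin := by
    ext f
    rw [LinearMap.mem_ker, Matrix.mulVecLin_apply, LinearMap.mem_range]
    constructor
    · rintro ⟨g, rfl⟩
      ext e
      have : p (G.src e) = p (G.tgt e) := Quot.sound ⟨e, rfl, rfl⟩
      simp [coboundaryMatrix_mulVec, LinearMap.funLeft_apply, this]
    · intro h
      refine ⟨Quot.lift f ?_, rfl⟩
      rintro _ _ ⟨e, rfl, rfl⟩
      have := congrFun h e
      rw [coboundaryMatrix_mulVec, Pi.zero_apply, sub_eq_zero] at this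
      exact this.symm
  rw [← hrange, LinearMap.finrank_range_of_inj (LinearMap.funLeft_injective_of_surjective ℝ ℝ p hp),
    Module.finrank_fintype_fun_eq_card, Nat.card_eq_fintype_card]

/-- Rank-nullity for the coboundary matrix and for its transpose, which have equal rank. -/
theorem finrank_circulations [Finite V] [Fintype E] (G : DirectedMultigraph V E) :
    Module.finrank ℝ G.circulations + Nat.card V = Nat.card E + Nat.card G.Components := by
  classical
  have := Fintype.ofFinite V
  have h1 := G.coboundaryMatrix.mulVecLin.finrank_range_add_finrank_ker
  have h2 := G.coboundaryMatrix.transpose.mulVecLin.finrank_range_add_finrank_ker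
  have h3 : Module.finrank ℝ (LinearMap.range G.coboundaryMatrix.transpose.mulVecLin) =
    Module.finrank ℝ (LinearMap.range G.coboundaryMatrix.mulVecLin) :=
    G.coboundaryMatrix.rank_transpose
  rw [finrank_ker_coboundaryMatrix] at h1
  rw [← circulations_eq_ker] at h2
  simp only [Module.finrank_fintype_fun_eq_card, ← Nat.card_eq_fintype_card] at h1 h2
  omega

/-! ### Points of maximal support and the dimension of `P(G)` -/

/-- Positive coordinates stay positive under a small move, and vanishing ones do not decrease. -/
theorem exists_pos_add_smul_mem_cyclePolytope [Finite V] [Fintype E] {G : DirectedMultigraph V E}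
    {y d : E → ℝ} (hy : y ∈ G.cyclePolytope) (hd : d ∈ G.circulations) (hsum : ∑ e, d e = 0)
    (hyd : ∀ e, y e = 0 → 0 ≤ d e) : ∃ δ : ℝ, 0 < δ ∧ y + δ • d ∈ G.cyclePolytope := by
  obtain ⟨hyc, hy0, hy1⟩ := mem_cyclePolytope_iff.1 hy
  have hev : ∀ᶠ δ in nhdsWithin (0 : ℝ) (Set.Ioi 0), ∀ e, 0 ≤ y e + δ * d e := by
    refine Filter.eventually_all.2 fun e => ?_
    rcases (hy0 e).eq_or_lt with h | h
    · filter_upwards [self_mem_nhdsWithin] with δ hδ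
      rw [← h, zero_add]
      exact mul_nonneg (le_of_lt hδ) (hyd e h.symm)
    · have hcont : Continuous fun δ : ℝ => y e + δ * d e := by fun_prop
      have := (hcont.tendsto 0).eventually (lt_mem_nhds (a := 0) (by simpa using h))
      exact (this.filter_mono nhdsWithin_le_nhds).mono fun δ hδ => hδ.le
  obtain ⟨δ, hδ, hpos⟩ := (hev.and self_mem_nhdsWithin).exists
  refine ⟨δ, hpos, mem_cyclePolytope_iff.2
    ⟨add_mem hyc (Submodule.smul_mem _ _ hd), fun e => by simpa using hδ e, ?_⟩⟩
  simp [Finset.sum_add_distrib, ← Finset.mul_sum, hy1, hsum]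

/-- A non-empty convex set of nonnegative vectors contains one of maximal support. -/
theorem _root_.Convex.exists_mem_forall_pos [Finite E] {F : Set (E → ℝ)} (hF : Convex ℝ F)
    (hne : F.Nonempty) (h0 : ∀ x ∈ F, ∀ e, 0 ≤ x e) :
    ∃ y ∈ F, ∀ e, (∃ x ∈ F, 0 < x e) → 0 < y e := by
  have := Fintype.ofFinite E
  rcases isEmpty_or_nonempty E with hE | hE
  · obtain ⟨y, hy⟩ := hne
    exact ⟨y, hy, fun e => hE.elim e⟩
  have hex : ∀ e, ∃ z ∈ F, (∃ x ∈ F, 0 < x e) → 0 < z e := by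
    intro e
    by_cases h : ∃ x ∈ F, 0 < x e
    · obtain ⟨x, hx, hxe⟩ := h
      exact ⟨x, hx, fun _ => hxe⟩
    · obtain ⟨y, hy⟩ := hne
      exact ⟨y, hy, fun h' => absurd h' h⟩
  choose z hzF hz using hex
  have hw : (0 : ℝ) < (Fintype.card E : ℝ)⁻¹ := by positivity
  -- The average of one witness per edge.
  refine ⟨∑ e, (Fintype.card E : ℝ)⁻¹ • z e, hF.sum_mem (fun _ _ => hw.le) (by simp)
    fun e _ => hzF e, fun e he => ?_⟩
  simp only [Finset.sum_apply, Pi.smul_apply, smul_eq_mul]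
  exact Finset.sum_pos' (fun e' _ => mul_nonneg hw.le (h0 _ (hzF e') e))
    ⟨e, Finset.mem_univ e, mul_pos hw (hz e he)⟩

theorem polytopeDim_cyclePolytope [Finite V] [Finite E] {G : DirectedMultigraph V E}
    (hG : G.IsFull) :
    polytopeDim G.cyclePolytope =
      (Nat.card E : ℤ) - (Nat.card V : ℤ) + (Nat.card G.Components : ℤ) - 1 := by
  have := Fintype.ofFinite E
  have hcirc := G.finrank_circulations
  rcases isEmpty_or_nonempty E with hE | ⟨⟨e₀⟩⟩
  · have hP : G.cyclePolytope = ∅ := by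
      refine Set.eq_empty_of_forall_notMem fun x hx => ?_
      simpa using (mem_cyclePolytope_iff.1 hx).2.2
    -- Without edges there are as many components as vertices, so the formula gives -1, the
    -- dimension of `∅`.
    have h0 : Module.finrank ℝ G.circulations = 0 := by
      have := Submodule.finrank_le G.circulations
      simpa using this
    rw [polytopeDim, if_pos hP]
    simp only [Nat.card_of_isEmpty] at hcirc ⊢
    omega
  · have hne : G.cyclePolytope.Nonempty := by
      obtain ⟨c, hc, -⟩ := hG e₀
      exact ⟨_, hc.cycleVector_mem_cyclePolytope⟩
    obtain ⟨y, hy, hypos⟩ := (convex_convexHull ℝ _ : Convex ℝ G.cyclePolytope).exists_mem_forall_pos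
      hne fun x hx => (mem_cyclePolytope_iff.1 hx).2.1
    replace hypos : ∀ e, 0 < y e := fun e => by
      obtain ⟨c, hc, he⟩ := hG e
      exact hypos e ⟨_, hc.cycleVector_mem_cyclePolytope, cycleVector_pos he⟩
    obtain ⟨hyc, -, hy1⟩ := mem_cyclePolytope_iff.1 hy
    let σ : (E → ℝ) →ₗ[ℝ] ℝ := ∑ e, LinearMap.proj e
    have hσ : ∀ x, σ x = ∑ e, x e := fun x => by simp [σ]
    let τ : G.circulations →ₗ[ℝ] ℝ := σ.comp G.circulations.subtype
    have hτ : LinearMap.range τ = ⊤ :=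
      LinearMap.range_eq_top.2 fun r => ⟨r • ⟨y, hyc⟩, by simp [τ, hσ, ← Finset.mul_sum, hy1]⟩
    have hdir : (affineSpan ℝ G.cyclePolytope).direction =
        (LinearMap.ker τ).map G.circulations.subtype := by
      rw [direction_affineSpan]
      apply le_antisymm
      · rw [vectorSpan_def, Submodule.span_le]
        rintro _ ⟨a, ha, b, hb, rfl⟩
        obtain ⟨hac, -, ha1⟩ := mem_cyclePolytope_iff.1 ha
        obtain ⟨hbc, -, hb1⟩ := mem_cyclePolytope_iff.1 hb
        refine ⟨⟨a - b, sub_mem hac hbc⟩, ?_, rfl⟩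
        simp [τ, hσ, ha1, hb1]
      · rintro _ ⟨⟨d, hd⟩, hd0, rfl⟩
        have hdsum : ∑ e, d e = 0 := by
          rw [← hσ]; exact hd0
        obtain ⟨δ, hδ, hmem⟩ := exists_pos_add_smul_mem_cyclePolytope hy hd hdsum
          fun e he => absurd he (hypos e).ne'
        have := vsub_mem_vectorSpan ℝ hmem hy
        rw [vsub_eq_sub, add_sub_cancel_left] at this
        exact (Submodule.smul_mem_iff _ hδ.ne').1 this
    have hker := τ.finrank_range_add_finrank_ker
    rw [hτ, finrank_top, Module.finrank_self] at hker
    rw [polytopeDim, if_neg hne.ne_empty, hdir,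
      Submodule.finrank_map_subtype_eq]
    omega

/-! ### Subgraphs and extension by zero -/

theorem _root_.polytopeDim_image_of_injective {ι κ : Type*} (f : (ι → ℝ) →ₗ[ℝ] (κ → ℝ))
    (hf : Function.Injective f) (P : Set (ι → ℝ)) : polytopeDim (f '' P) = polytopeDim P := by
  have h : (affineSpan ℝ (f '' P)).direction = (affineSpan ℝ P).direction.map f := by
    rw [direction_affineSpan, direction_affineSpan]
    exact (f.toAffineMap.map_vectorSpan (s := P)).symm
  simp only [polytopeDim, Set.image_eq_empty]
  rw [h, LinearEquiv.finrank_eq (Submodule.equivMapOfInjective f hf _)]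

theorem sum_extendByZero_mul [Fintype E] (s : Set E) [Fintype s] (x : s → ℝ) (g : E → ℝ) :
    ∑ e, Function.ExtendByZero.linearMap ℝ (Subtype.val : s → E) x e * g e =
      ∑ e : s, x e * g e := by
  classical
  symm
  refine Finset.sum_of_injOn Subtype.val Subtype.val_injective.injOn (by simp) ?_ ?_
  · intro e _ he
    rw [Function.ExtendByZero.linearMap_apply, Function.extend_apply', Pi.zero_apply, zero_mul]
    rintro ⟨e', rfl⟩
    exact he ⟨e', by simp, rfl⟩
  · intro e _
    rw [Function.ExtendByZero.linearMap_apply, Subtype.val_injective.extend_apply]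

theorem Subgraph.extendByZero_mem_circulations_iff [Fintype E] {G : DirectedMultigraph V E}
    (H : G.Subgraph) [Fintype H.edges] (x : H.edges → ℝ) :
    Function.ExtendByZero.linearMap ℝ (Subtype.val : H.edges → E) x ∈ G.circulations ↔
      x ∈ H.coe.circulations := by
  simp only [mem_circulations]
  constructor
  · intro h f
    -- The values outside `H.verts` are irrelevant: edges of `H` have both ends inside.
    have := h (Function.extend Subtype.val f 0)
    rw [sum_extendByZero_mul H.edges x fun e => Function.extend Subtype.val f 0 (G.tgt e) -
      Function.extend Subtype.val f 0 (G.src e)] at this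
    rw [← this]
    refine Finset.sum_congr rfl fun e _ => ?_
    congr 2
    · exact (Subtype.val_injective.extend_apply f 0 (H.coe.tgt e)).symm
    · exact (Subtype.val_injective.extend_apply f 0 (H.coe.src e)).symm
  · intro h f
    rw [sum_extendByZero_mul H.edges x fun e => f (G.tgt e) - f (G.src e)]
    exact h fun v => f v

theorem Subgraph.image_cyclePolytope [Finite V] [Finite E] {G : DirectedMultigraph V E}
    (H : G.Subgraph) :
    Function.ExtendByZero.linearMap ℝ (Subtype.val : H.edges → E) '' H.coe.cyclePolytope =
      G.restrictedPolytope H := by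
  have := Fintype.ofFinite E
  have := Fintype.ofFinite H.edges
  have hsum : ∀ x : H.edges → ℝ,
      ∑ e, Function.ExtendByZero.linearMap ℝ (Subtype.val : H.edges → E) x e = ∑ e, x e := by
    intro x
    simpa using sum_extendByZero_mul H.edges x fun _ => 1
  have hval : ∀ (x : H.edges → ℝ) (e : H.edges),
      Function.ExtendByZero.linearMap ℝ (Subtype.val : H.edges → E) x e = x e := fun x e =>
    Subtype.val_injective.extend_apply x 0 e
  have hzero : ∀ (x : H.edges → ℝ), ∀ e ∉ H.edges,
      Function.ExtendByZero.linearMap ℝ (Subtype.val : H.edges → E) x e = 0 := by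
    intro x e he
    refine Function.extend_apply' _ _ _ ?_
    rintro ⟨e', rfl⟩
    exact he e'.2
  ext y
  constructor
  · rintro ⟨x, hx, rfl⟩
    obtain ⟨hxc, hx0, hx1⟩ := mem_cyclePolytope_iff.1 hx
    refine ⟨mem_cyclePolytope_iff.2 ⟨(H.extendByZero_mem_circulations_iff x).2 hxc, fun e => ?_,
      (hsum x).trans hx1⟩, hzero x⟩
    by_cases he : e ∈ H.edges
    · exact (hval x ⟨e, he⟩).symm ▸ hx0 _
    · exact (hzero x e he).ge
  · rintro ⟨hy, hyH⟩
    obtain ⟨hyc, hy0, hy1⟩ := mem_cyclePolytope_iff.1 hy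
    have hext : Function.ExtendByZero.linearMap ℝ (Subtype.val : H.edges → E)
        (fun e => y e) = y := by
      ext e
      by_cases he : e ∈ H.edges
      · exact hval (fun e => y e) ⟨e, he⟩
      · rw [hzero _ e he, hyH e he]
    refine ⟨fun e => y e, mem_cyclePolytope_iff.2 ⟨?_, fun e => hy0 e, ?_⟩, hext⟩
    · rwa [← H.extendByZero_mem_circulations_iff, hext]
    · rwa [← hsum, hext]

theorem polytopeDim_restrictedPolytope [Finite V] [Finite E] {G : DirectedMultigraph V E}
    (H : G.FullSubgraph) :
    polytopeDim (G.restrictedPolytope H.toSubgraph) =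
      (H.edges.ncard : ℤ) - (H.verts.ncard : ℤ) +
        (Nat.card H.toSubgraph.coe.Components : ℤ) - 1 := by
  rw [← H.toSubgraph.image_cyclePolytope, polytopeDim_image_of_injective,
    polytopeDim_cyclePolytope H.full, Nat.card_coe_set_eq, Nat.card_coe_set_eq]
  exact fun x y h => Function.extend_injective Subtype.val_injective (0 : E → ℝ) h

/-! ### Faces and full subgraphs -/

theorem isExposed_restrictedPolytope [Finite V] [Finite E] (G : DirectedMultigraph V E)
    (H : G.Subgraph) : IsExposed ℝ G.cyclePolytope (G.restrictedPolytope H) := by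
  classical
  have := Fintype.ofFinite E
  rintro ⟨x₀, hx₀, hx₀H⟩
  -- On `P(G)` this functional is at most 0, with equality exactly on `P(G)_H`. `x₀` shows that 0 is
  -- attained; the empty set is exposed by definition.
  let l : StrongDual ℝ (E → ℝ) :=
    -∑ e ∈ Finset.univ.filter (· ∉ H.edges), ContinuousLinearMap.proj e
  have hl : ∀ x, l x = -∑ e ∈ Finset.univ.filter (· ∉ H.edges), x e := fun x => by simp [l]
  refine ⟨l, Set.ext fun x => ⟨fun ⟨hx, hxH⟩ => ⟨hx, fun y hy => ?_⟩, fun ⟨hx, hmax⟩ =>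
    ⟨hx, fun e he => ?_⟩⟩⟩
  · rw [hl, hl, neg_le_neg_iff,
      Finset.sum_eq_zero fun e he => hxH e (Finset.mem_filter.1 he).2]
    exact Finset.sum_nonneg fun e _ => (mem_cyclePolytope_iff.1 hy).2.1 e
  · have h := hmax x₀ hx₀
    have hx0 := (mem_cyclePolytope_iff.1 hx).2.1
    rw [hl, hl, neg_le_neg_iff,
      Finset.sum_eq_zero fun e he => hx₀H e (Finset.mem_filter.1 he).2] at h
    refine (Finset.sum_eq_zero_iff_of_nonneg fun e _ => hx0 e).1
      (h.antisymm (Finset.sum_nonneg fun e _ => hx0 e)) e (by simpa using he)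

/-- Fullness lets `P(G)_H` recover the edges of `H`: each lies on a cycle in `H`, whose vector is
positive there. -/
theorem restrictedPolytope_subset_iff [Finite V] [Finite E] {G : DirectedMultigraph V E}
    {H H' : G.FullSubgraph} :
    G.restrictedPolytope H.toSubgraph ⊆ G.restrictedPolytope H'.toSubgraph ↔ H ≤ H' := by
  have := Fintype.ofFinite H.edges
  constructor
  · intro h e he
    by_contra he'
    obtain ⟨c, hc, hec⟩ := H.full ⟨e, he⟩
    have hmem := h (H.toSubgraph.image_cyclePolytope ▸
      Set.mem_image_of_mem _ hc.cycleVector_mem_cyclePolytope)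
    have hval : Function.ExtendByZero.linearMap ℝ (Subtype.val : H.edges → E) (cycleVector c) e =
      cycleVector c ⟨e, he⟩ := Subtype.val_injective.extend_apply (cycleVector c) 0 ⟨e, he⟩
    exact (cycleVector_pos hec).ne' (hval.symm.trans (hmem.2 e he'))
  · rintro h x ⟨hx, hxH⟩
    exact ⟨hx, fun e he => hxH e fun he' => he (h he')⟩

theorem Subgraph.isWalk_map_val_iff {G : DirectedMultigraph V E} (H : G.Subgraph)
    {c : List H.edges} {u v : H.verts} :
    G.IsWalk u (c.map Subtype.val) v ↔ H.coe.IsWalk u c v := by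
  induction c generalizing u with
  | nil => exact Subtype.ext_iff.symm
  | cons e c ih =>
    exact and_congr (Subtype.ext_iff (a1 := H.coe.src e)).symm (ih (u := H.coe.tgt e))

/-- Every edge used by a point of the cycle polytope lies on a cycle of edges used by that point. -/
theorem exists_isCycle_of_pos [Finite V] [Finite E] {G : DirectedMultigraph V E} {x : E → ℝ}
    (hx : x ∈ G.cyclePolytope) {e : E} (he : 0 < x e) :
    ∃ c, G.IsCycle c ∧ e ∈ c ∧ ∀ e' ∈ c, 0 < x e' := by
  obtain ⟨ι, _, w, z, hw, -, hz, rfl⟩ := mem_convexHull_iff_exists_fintype.1 hx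
  simp only [Finset.sum_apply, Pi.smul_apply, smul_eq_mul] at he ⊢
  have hz0 : ∀ i e, 0 ≤ z i e := fun i e => by
    obtain ⟨c, -, hc⟩ := hz i
    exact hc ▸ cycleVector_nonneg c e
  obtain ⟨i, -, hi⟩ := Finset.exists_lt_of_sum_lt (s := Finset.univ) (f := fun _ : ι => (0 : ℝ))
    (by simpa using he)
  obtain ⟨c, hc, hzc⟩ := hz i
  have hwi : 0 < w i := pos_of_mul_pos_left hi (hz0 i e)
  refine ⟨c, hc.1, mem_of_cycleVector_pos (hzc ▸ pos_of_mul_pos_right hi (hw i)), fun e' he' => ?_⟩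
  exact Finset.sum_pos' (fun j _ => mul_nonneg (hw j) (hz0 j e'))
    ⟨i, Finset.mem_univ i, mul_pos hwi (hzc ▸ cycleVector_pos he')⟩

/-- The full subgraph of the edges that are used by some point of a set `F ⊆ P(G)`. -/
def supportSubgraph [Finite V] [Finite E] (G : DirectedMultigraph V E) (F : Set (E → ℝ))
    (hF : F ⊆ G.cyclePolytope) : G.FullSubgraph where
  verts := Set.univ
  edges := {e | ∃ x ∈ F, 0 < x e}
  src_mem _ _ := Set.mem_univ _
  tgt_mem _ _ := Set.mem_univ _
  full := by
    rintro ⟨e, x, hx, he⟩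
    obtain ⟨c, ⟨hne, v, hv⟩, hec, hc⟩ := exists_isCycle_of_pos (hF hx) he
    lift c to List {e | ∃ x ∈ F, 0 < x e} using fun e' he' => ⟨x, hx, hc e' he'⟩
    refine ⟨c, ⟨by rintro rfl; exact hne rfl, ⟨v, Set.mem_univ v⟩, ?_⟩, ?_⟩
    · exact (Subgraph.isWalk_map_val_iff (G := G) ⟨_, _, _, _⟩).1 hv
    · obtain ⟨e', he', rfl⟩ := List.mem_map.1 hec
      exact he'

theorem restrictedPolytope_supportSubgraph [Finite V] [Finite E] (G : DirectedMultigraph V E)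
    {F : Set (E → ℝ)} (hF : IsExposed ℝ G.cyclePolytope F) :
    G.restrictedPolytope (G.supportSubgraph F hF.subset).toSubgraph = F := by
  have := Fintype.ofFinite E
  have hP : Convex ℝ G.cyclePolytope := convex_convexHull ℝ _
  have hF0 : ∀ x ∈ F, ∀ e, 0 ≤ x e := fun x hx => (mem_cyclePolytope_iff.1 (hF.subset hx)).2.1
  refine Set.Subset.antisymm ?_ fun x hx => ⟨hF.subset hx, fun e he => ?_⟩
  · rintro z ⟨hz, hzF⟩
    obtain ⟨hzc, hz0, hz1⟩ := mem_cyclePolytope_iff.1 hz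
    have hne : F.Nonempty := by
      by_contra hne
      rw [Set.not_nonempty_iff_eq_empty] at hne
      have : ∑ e, z e = 0 := Finset.sum_eq_zero fun e _ => hzF e (by simp [supportSubgraph, hne])
      exact zero_ne_one (this.symm.trans hz1)
    obtain ⟨y, hyF, hy⟩ := (hF.convex hP).exists_mem_forall_pos hne hF0
    obtain ⟨hyc, -, hy1⟩ := mem_cyclePolytope_iff.1 (hF.subset hyF)
    -- Moving from `y` away from `z` stays in `P(G)`, as `z` vanishes wherever `y` does. Maximality
    -- of `l` at `y` then gives `l y ≤ l z`.
    obtain ⟨δ, hδ, hmem⟩ := exists_pos_add_smul_mem_cyclePolytope (hF.subset hyF)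
      (sub_mem hyc hzc) (by simp [hy1, hz1]) fun e he => by
        have : z e = 0 := hzF e fun h => (hy e h).ne' he
        simp [he, this]
    obtain ⟨l, rfl⟩ := hF hne
    refine ⟨hz, fun x hx => (hyF.2 x hx).trans ?_⟩
    have h := hyF.2 _ hmem
    rw [map_add, map_smul, map_sub, smul_eq_mul, add_le_iff_nonpos_right] at h
    exact sub_nonpos.1 (nonpos_of_mul_nonpos_right h hδ)
  · by_contra hne
    exact he ⟨x, hx, (hF0 x hx e).lt_of_ne' hne⟩

theorem exists_fullSubgraphPoset_orderIso [Finite V] [Finite E] (G : DirectedMultigraph V E) :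
    ∃ φ : G.FullSubgraphPoset ≃o FacePoset G.cyclePolytope,
      ∀ H : G.FullSubgraph,
        (φ (toAntisymmetrization (· ≤ ·) H) : Set (E → ℝ)) =
          G.restrictedPolytope H.toSubgraph := by
  let f : G.FullSubgraph → FacePoset G.cyclePolytope := fun H =>
    ⟨G.restrictedPolytope H.toSubgraph, G.isExposed_restrictedPolytope H.toSubgraph⟩
  have hf : ∀ H H', f H ≤ f H' ↔ H ≤ H' := fun _ _ => restrictedPolytope_subset_iff
  let g : G.FullSubgraphPoset → FacePoset G.cyclePolytope := Quotient.lift f fun H H' h =>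
    le_antisymm ((hf H H').2 h.1) ((hf H' H).2 h.2)
  have hg : ∀ a b, g a ≤ g b ↔ a ≤ b := by
    intro a b
    induction a using Antisymmetrization.ind with | _ H
    induction b using Antisymmetrization.ind with | _ H'
    exact (hf H H').trans toAntisymmetrization_le_toAntisymmetrization_iff.symm
  refine ⟨RelIso.ofSurjective (OrderEmbedding.ofMapLEIff g hg) fun F => ?_, fun H => rfl⟩
  exact ⟨toAntisymmetrization _ (G.supportSubgraph F.1 F.2.subset),
    Subtype.ext (G.restrictedPolytope_supportSubgraph F.2)⟩

end DirectedMultigraph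

theorem theorem3p2 {V E : Type*} [Finite V] [Finite E] (G : DirectedMultigraph V E) :
    (∃ φ : G.FullSubgraphPoset ≃o FacePoset G.cyclePolytope,
      ∀ H : G.FullSubgraph,
        (φ (toAntisymmetrization (· ≤ ·) H) : Set (E → ℝ)) =
          G.restrictedPolytope H.toSubgraph) ∧
    (∀ H : G.FullSubgraph,
      Function.ExtendByZero.linearMap ℝ (Subtype.val : H.edges → E) ''
          H.toSubgraph.coe.cyclePolytope =
        G.restrictedPolytope H.toSubgraph) ∧
    (∀ H : G.FullSubgraph,
      polytopeDim (G.restrictedPolytope H.toSubgraph) =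
        (H.edges.ncard : ℤ) - (H.verts.ncard : ℤ) +
          (Nat.card H.toSubgraph.coe.Components : ℤ) - 1) :=
  ⟨G.exists_fullSubgraphPoset_orderIso, fun H => H.toSubgraph.image_cyclePolytope,
    DirectedMultigraph.polytopeDim_restrictedPolytope⟩
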